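/- **Theorem.** All vector lattices are real and Archimedean, linear topologies are Hausdorff, and directed sets are non-empty. Let $E$ be a vector lattice with a Fatou topology $\tau$, i.e. a linear topology for which zero has a neighbourhood basis of order closed solid sets. Let $$C_\tau=\bigcup\Big\{\Big(\bigcap_{n\ge1}V_n\Big)^{\mathrm d}\Big\}$$ be its carrier, where the union runs over all sequences $(V_n)_{n\ge 1}$ of solid $\tau$-neighbourhoods of zero with $V_{n+1}+V_{n+1}\subseteq V_n$ for all $n$, and $S^{\mathrm d}=\{x\in E:|x|\wedge|s|=0\text{ for all }s\in S\}$. (a) Each of the following three conditions implies that $C_\tau=E$: (i) $E$ has the countable sup property, i.e. every subset of $E$ with a supremum contains an at most countable subset with the same supremum; (ii) $C_\tau$ has a countable order basis, i.e. there is a non-empty, at most countable set $B\subseteq C_\tau$ such that $B^{\mathrm d}\cap C_\tau=\{0\}$; (iii) $\tau$ is metrisable. (b) Suppose that $C_\tau=E$. Let $(x_\alpha)_{\alpha\in A}$ be a net in $E$ and let $x\in E$ be such that $x_\alpha\to x$ in $\tau$. Then there are indices $\alpha_1\le\alpha_2\le\alpha_3\le\cdots$ in $A$, with $\alpha_1<\alpha_2<\alpha_3<\cdots$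 when $A$ has no largest element, such that the embedded sequence $(x_{\alpha_n})_{n\ge1}$ is unbounded order convergent to $x$ in $E$. Here a net $(z_\alpha)_{\alpha\in A}$ in $E$ converges in order to $z\in E$ if there is a net $(y_\beta)_{\beta\in B}$ in $E$ with $y_\beta\downarrow0$ such that for every $\beta_0\in B$ there is an $\alpha_0\in A$ with $|z_\alpha-z|\le y_{\beta_0}$ for all $\alpha\ge\alpha_0$. It is unbounded order convergent to $z$ if $|z_\alpha-z|\wedge|y|$ converges in order to $0$ for every $y\in E$. A set is order closed if it contains the limits of all order convergent nets in it. -/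

import Mathlib

open Filter Topology Set
open scoped Pointwise

universe u v w

namespace VectorLattice

section Order

variable (E : Type u) [AddCommGroup E] [Lattice E]

/-- The Archimedean property of a vector lattice: if `x ≥ 0` and all multiples `n • x` lie below a
common element, then `x = 0`. (Mathlib's `Archimedean` asks every positive element to be an order
unit, which is a different notion for orders that are not linear.) -/
def IsArchimedean : Prop :=
  ∀ x y : E, 0 ≤ x → (∀ n : ℕ, n • x ≤ y) → x = 0

/-- The countable sup property: every subset that has a supremum contains an at most countable
subset with the same supremum. -/
def CountableSupProperty : Prop :=
  ∀ (S : Set E) (a : E), IsLUB S a → ∃ T : Set E, T ⊆ S ∧ T.Countable ∧ IsLUB T a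

variable {E}

/-- The disjoint complement `S^d` of a subset of a vector lattice. -/
def disjointCompl (S : Set E) : Set E :=
  {x | ∀ s ∈ S, |x| ⊓ |s| = 0}

/-- `B` is an order basis of the (sub)lattice `F`: it is a non-empty subset of `F` whose disjoint
complement, taken in `F`, is zero. -/
def IsOrderBasis (B F : Set E) : Prop :=
  B.Nonempty ∧ B ⊆ F ∧ disjointCompl B ∩ F = {0}

/-- `x_α → a` in order: there is a net `y_β ↓ 0` such that, for every `β₀`, eventually
`|x_α - a| ≤ y_{β₀}`. The index set of `y` may be taken in the universe of `E`, since a net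
decreasing to zero can be replaced by the set of its values with the reversed order. -/
def OrderTendsto {A : Type v} [Preorder A] (x : A → E) (a : E) : Prop :=
  ∃ (B : Type u) (_ : Preorder B) (_ : IsDirectedOrder B) (_ : Nonempty B) (y : B → E),
    Antitone y ∧ IsGLB (range y) 0 ∧ ∀ β₀ : B, ∃ α₀ : A, ∀ α : A, α₀ ≤ α → |x α - a| ≤ y β₀

/-- Unbounded order convergence: `|x_α - a| ⊓ |y| → 0` in order, for every `y`. -/
def UOTendsto {A : Type v} [Preorder A] (x : A → E) (a : E) : Prop :=
  ∀ y : E, OrderTendsto (fun α => |x α - a| ⊓ |y|) 0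

/-- `S` is order closed: it contains the limits of all order convergent nets in `S`. Nets with
index sets in the universe of `E` suffice: if `x_α → a` in order with dominating net `(y_β)`, then
choosing for each `β` an index `α_β` from which `|x_α - a| ≤ y_β` yields a net `(x_{α_β})_β` in `S`
that converges in order to `a`. -/
def IsOrderClosed (S : Set E) : Prop :=
  ∀ (A : Type u) [Preorder A] [IsDirectedOrder A] [Nonempty A] (x : A → E) (a : E),
    (∀ α, x α ∈ S) → OrderTendsto x a → a ∈ S

end Order

/-- The sequence `s` is embedded in the net `x`: `s n = x (α n)` for some indices
`α 0 ≤ α 1 ≤ α 2 ≤ ⋯`, which are strictly increasing when `A` has no largest element. -/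
def IsEmbeddedSequence {S : Type u} {A : Type v} [Preorder A] (s : ℕ → S) (x : A → S) : Prop :=
  ∃ α : ℕ → A, Monotone α ∧ ((¬ ∃ m : A, IsTop m) → StrictMono α) ∧ ∀ n, s n = x (α n)

section Topology

variable (E : Type u) [AddCommGroup E] [Lattice E] [Module ℝ E] [TopologicalSpace E]

/-- A locally solid topology: a Hausdorff linear topology for which zero has a neighbourhood basis
of solid sets. -/
structure IsLocallySolidTopology : Prop where
  isTopologicalAddGroup : IsTopologicalAddGroup E
  continuousSMul : ContinuousSMul ℝ E
  t2Space : T2Space E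
  solid_basis : ∀ U ∈ 𝓝 (0 : E), ∃ V ∈ 𝓝 (0 : E),
    LatticeOrderedAddCommGroup.IsSolid V ∧ V ⊆ U

/-- A Fatou topology: a locally solid topology for which zero has a neighbourhood basis of order
closed solid sets. -/
structure IsFatouTopology : Prop extends IsLocallySolidTopology E where
  fatou_basis : ∀ U ∈ 𝓝 (0 : E), ∃ V ∈ 𝓝 (0 : E),
    LatticeOrderedAddCommGroup.IsSolid V ∧ IsOrderClosed V ∧ V ⊆ U

end Topology

section Carrier

variable {E : Type u} [AddCommGroup E] [Lattice E] [TopologicalSpace E]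

/-- A normal sequence of solid neighbourhoods of zero. -/
structure IsNormalSolidSequence (V : ℕ → Set E) : Prop where
  mem_nhds : ∀ n, V n ∈ 𝓝 (0 : E)
  solid : ∀ n, LatticeOrderedAddCommGroup.IsSolid (V n)
  add_subset : ∀ n, V (n + 1) + V (n + 1) ⊆ V n

variable (E) in
/-- The carrier `C_τ` of the topology `τ` of `E`: the union of the disjoint complements `N^d`, where
`N` runs over the intersections of the normal sequences of solid neighbourhoods of zero. -/
def carrier : Set E :=
  {x | ∃ V : ℕ → Set E, IsNormalSolidSequence V ∧ x ∈ disjointCompl (⋂ n, V n)}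

end Carrier

end VectorLattice

/-!
The elementary tool is `IsArchimedean.eq_zero_of_sub_mem`: a non-empty set that is bounded below
and stable under subtraction of some `d ≥ 0` forces `d = 0`. It takes the place of the Dedekind
completion throughout. It shows that an element `x ≥ 0` of the double disjoint complement of an
ideal `I` is the supremum of the elements of `I` in `[0, x]`; hence an order closed ideal contains
its double disjoint complement.

The kernel `N = ⋂ n, V n` of a normal sequence of solid neighbourhoods of zero is an ideal. By
`exists_normal_orderClosed_refinement` the `V n` can be taken order closed and below any prescribed
sequence of neighbourhoods. So `N` can be shrunk to avoid a given non-zero element, which gives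
`carrier E ^d = 0`, and any countable subset of the carrier lies in a single `N^d`. These two facts
yield the three sufficient conditions for the carrier to be everything.

For the embedded sequence, indices `α n` and normal sequences `V n` of order closed sets are
chosen alternately: `x (α n) - a` is to lie in `(⋂ m, V n m)^d`, the `V n` decrease with `n`, and
`x (α (n + 1)) - a ∈ V n (n + 1)`. The diagonal sequence `W n = V n (n + 1)` is then normal, the
differences `z n = x (α n) - a` all lie in `(⋂ n, W n)^d`, and `z (n + 1) ∈ W n`. Given `y`, let
`U` be the set of elements that dominate `|z m| ⊓ |y|` for all large `m`. It is directed downwards,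
and if `w ≥ 0` is a lower bound of `U`, then `w` is disjoint from `⋂ n, W n`, while
`w = sup_p (w ⊓ sup_{n ≤ m ≤ p} |z m| ⊓ |y|)` for each `n`, so that `w ∈ ⋂ n, W n` because the
`W n` are order closed. Therefore `w = 0`, and `U` witnesses the order convergence.
-/

namespace VectorLattice

open LatticeOrderedAddCommGroup

section Order

variable {E : Type u} [AddCommGroup E] [Lattice E]

/-! ### Order closed sets and normal sequences -/

theorem isOrderClosed_iInter {ι : Type*} {V : ι → Set E} (h : ∀ i, IsOrderClosed (V i)) :
    IsOrderClosed (⋂ i, V i) := fun A _ _ _ x a hx hxa =>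
  mem_iInter.2 fun i => h i A x a (fun α => mem_iInter.1 (hx α) i) hxa

namespace IsNormalSolidSequence

variable [TopologicalSpace E] {V : ℕ → Set E}

theorem zero_mem (hV : IsNormalSolidSequence V) (n : ℕ) : (0 : E) ∈ V n :=
  mem_of_mem_nhds (hV.mem_nhds n)

theorem antitone (hV : IsNormalSolidSequence V) : Antitone V :=
  antitone_nat_of_succ_le fun n x hx => by
    simpa using hV.add_subset n (add_mem_add hx (hV.zero_mem (n + 1)))

theorem add_mem_iInter (hV : IsNormalSolidSequence V) :
    ∀ x ∈ ⋂ n, V n, ∀ y ∈ ⋂ n, V n, x + y ∈ ⋂ n, V n := fun _ hx _ hy =>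
  mem_iInter.2 fun n =>
    hV.add_subset n (add_mem_add (mem_iInter.1 hx (n + 1)) (mem_iInter.1 hy (n + 1)))

theorem isSolid_iInter (hV : IsNormalSolidSequence V) : IsSolid (⋂ n, V n) :=
  fun _ hx _ hyx => mem_iInter.2 fun n => hV.solid n (mem_iInter.1 hx n) hyx

theorem zero_mem_iInter (hV : IsNormalSolidSequence V) : (0 : E) ∈ ⋂ n, V n :=
  mem_iInter.2 hV.zero_mem

/-- Sums of any length stay in `V j` when the `i`-th term is taken from `V (j + 1 + i)`, since each
set of the sequence absorbs the sum of two copies of its successor. -/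
theorem sum_mem (hV : IsNormalSolidSequence V) (k : ℕ) :
    ∀ (j : ℕ) (f : ℕ → E), (∀ i, f i ∈ V (j + 1 + i)) → ∑ i ∈ Finset.range k, f i ∈ V j := by
  induction k with
  | zero => exact fun j _ _ => by simpa using hV.zero_mem j
  | succ k ih =>
    intro j f hf
    rw [Finset.sum_range_succ']
    refine hV.add_subset j (add_mem_add (ih (j + 1) (fun i => f (i + 1)) fun i => ?_) (hf 0))
    have := hf (i + 1)
    rwa [← add_assoc, add_right_comm] at this

theorem partialSups_mem [IsOrderedAddMonoid E] (hV : IsNormalSolidSequence V) {j : ℕ} {f : ℕ → E}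
    (hf0 : ∀ i, 0 ≤ f i) (hf : ∀ i, f i ∈ V (j + 1 + i)) (p : ℕ) : partialSups f p ∈ V j := by
  have h0 : 0 ≤ partialSups f p := (hf0 p).trans (le_partialSups f p)
  refine hV.solid j (hV.sum_mem (p + 1) j f hf) ?_
  rw [abs_of_nonneg h0, abs_of_nonneg (Finset.sum_nonneg fun i _ => hf0 i)]
  refine partialSups_le f p _ fun i hi => ?_
  exact Finset.single_le_sum (fun i _ => hf0 i) (Finset.mem_range.2 (Nat.lt_succ_of_le hi))

end IsNormalSolidSequence

/-! ### Disjointness and the Archimedean property -/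

theorem inf_eq_zero_of_le {a b c d : E} (ha : 0 ≤ a) (hb : 0 ≤ b) (hac : a ≤ c) (hbd : b ≤ d)
    (h : c ⊓ d = 0) : a ⊓ b = 0 :=
  le_antisymm ((inf_le_inf hac hbd).trans h.le) (le_inf ha hb)

theorem disjointCompl_anti {S T : Set E} (h : S ⊆ T) : disjointCompl T ⊆ disjointCompl S :=
  fun _ hx s hs => hx s (h hs)

variable [IsOrderedAddMonoid E]

/-- The Archimedean property in the form in which it is applied: a non-empty set that is bounded
below and stable under subtraction of `d ≥ 0` forces `d = 0`. -/
theorem IsArchimedean.eq_zero_of_sub_mem (hArch : IsArchimedean E) {U : Set E} {b d : E}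
    (hU : U.Nonempty) (hb : b ∈ lowerBounds U) (hd : 0 ≤ d) (h : ∀ u ∈ U, u - d ∈ U) : d = 0 := by
  obtain ⟨u, hu⟩ := hU
  have hmem : ∀ n : ℕ, u - n • d ∈ U := by
    intro n
    induction n with
    | zero => simpa using hu
    | succ n ih =>
      have := h _ ih
      rwa [sub_sub, ← succ_nsmul] at this
  exact hArch d (u - b) hd fun n => le_sub_comm.1 (hb (hmem n))

theorem add_le_of_inf_eq_zero {a b c : E} (h : a ⊓ b = 0) (ha : a ≤ c) (hb : b ≤ c) :
    a + b ≤ c := by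
  rw [← inf_add_sup a b, h, zero_add]
  exact sup_le ha hb

theorem add_inf_le_inf_add_inf {a b c : E} (ha : 0 ≤ a) (hb : 0 ≤ b) (hc : 0 ≤ c) :
    (a + b) ⊓ c ≤ a ⊓ c + b ⊓ c := by
  rw [add_inf, inf_add, inf_add]
  refine le_inf (le_inf inf_le_left ?_) (le_inf ?_ ?_)
  · exact inf_le_right.trans (le_add_of_nonneg_right hb)
  · exact inf_le_right.trans (le_add_of_nonneg_left ha)
  · exact inf_le_right.trans (le_add_of_nonneg_left hc)

theorem isSolid_disjointCompl (S : Set E) : IsSolid (disjointCompl S) :=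
  fun _ hx _ hyx s hs => inf_eq_zero_of_le (abs_nonneg _) (abs_nonneg _) hyx le_rfl (hx s hs)

theorem add_mem_disjointCompl {S : Set E} {x y : E} (hx : x ∈ disjointCompl S)
    (hy : y ∈ disjointCompl S) : x + y ∈ disjointCompl S := by
  intro s hs
  refine le_antisymm ?_ (le_inf (abs_nonneg _) (abs_nonneg _))
  calc |x + y| ⊓ |s| ≤ (|x| + |y|) ⊓ |s| := inf_le_inf_right _ (abs_add_le x y)
    _ ≤ |x| ⊓ |s| + |y| ⊓ |s| :=
      add_inf_le_inf_add_inf (abs_nonneg _) (abs_nonneg _) (abs_nonneg _)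
    _ = 0 := by rw [hx s hs, hy s hs, add_zero]

theorem eq_zero_of_abs_inf_self {x : E} (h : |x| ⊓ |x| = 0) : x = 0 := by
  rw [inf_idem] at h
  exact le_antisymm ((le_abs_self x).trans h.le) (neg_nonpos.1 ((neg_le_abs x).trans h.le))

theorem zero_mem_disjointCompl (S : Set E) : (0 : E) ∈ disjointCompl S := fun s _ => by
  rw [abs_zero]
  exact inf_eq_left.2 (abs_nonneg s)

theorem disjointCompl_singleton_zero : disjointCompl ({0} : Set E) = univ := by
  refine eq_univ_of_forall fun x s hs => ?_
  rw [hs, abs_zero]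
  exact inf_eq_right.2 (abs_nonneg x)

/-- Disjoint complements are closed under suprema. -/
theorem mem_disjointCompl_of_isLUB {S T : Set E} {x : E} (hx : 0 ≤ x) (hT : T ⊆ disjointCompl S)
    (hLUB : IsLUB T x) : x ∈ disjointCompl S := by
  intro s hs
  rw [abs_of_nonneg hx]
  have hz : 0 ≤ x ⊓ |s| := le_inf hx (abs_nonneg s)
  have hub : x - x ⊓ |s| ∈ upperBounds T := by
    intro t ht
    have h0 : |t| ⊓ (x ⊓ |s|) = 0 :=
      inf_eq_zero_of_le (abs_nonneg _) hz le_rfl inf_le_right (hT ht s hs)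
    -- Since `t` may fail to be positive, the estimate is made for its positive part.
    have h1 : t⁺ ⊓ (x ⊓ |s|) = 0 :=
      inf_eq_zero_of_le (posPart_nonneg t) hz (sup_le (le_abs_self t) (abs_nonneg t)) le_rfl h0
    have h2 := add_le_of_inf_eq_zero h1 (sup_le (hLUB.1 ht) hx) inf_le_left
    exact le_sub_iff_add_le.2 ((add_le_add_left (le_posPart t) _).trans h2)
  have := hLUB.2 hub
  exact le_antisymm (by simpa using this) hz

/-- An element `x ≥ 0` of the double disjoint complement of an ideal `I` is the supremum of the
elements of `I` in `[0, x]`. -/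
theorem IsArchimedean.isLUB_of_mem_disjointCompl_disjointCompl (hArch : IsArchimedean E)
    {I : Set E} (h0 : (0 : E) ∈ I) (hsolid : IsSolid I) (hadd : ∀ x ∈ I, ∀ y ∈ I, x + y ∈ I)
    {x : E} (hx : 0 ≤ x) (hxI : x ∈ disjointCompl (disjointCompl I)) :
    IsLUB {c | c ∈ I ∧ 0 ≤ c ∧ c ≤ x} x := by
  refine ⟨fun c hc => hc.2.2, fun v hv => ?_⟩
  have hv0 : 0 ≤ v := hv ⟨h0, le_rfl, hx⟩
  -- The excess of `x` over `v` is disjoint from `I` and from `I^d`.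
  set d := x - x ⊓ v with hd
  have hd0 : 0 ≤ d := sub_nonneg.2 inf_le_left
  have hdx : d ≤ x := sub_le_self _ (le_inf hx hv0)
  have hdI : d ∈ disjointCompl I := by
    intro n hn
    rw [abs_of_nonneg hd0]
    have he0 : 0 ≤ d ⊓ |n| := le_inf hd0 (abs_nonneg n)
    have heI : d ⊓ |n| ∈ I := hsolid hn (by rw [abs_of_nonneg he0]; exact inf_le_right)
    refine hArch.eq_zero_of_sub_mem (U := (fun c => x - c) '' {c | c ∈ I ∧ 0 ≤ c ∧ c ≤ x})
      (b := 0) ⟨_, mem_image_of_mem _ ⟨h0, le_rfl, hx⟩⟩ ?_ he0 ?_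
    · rintro _ ⟨c, hc, rfl⟩
      exact sub_nonneg.2 hc.2.2
    · rintro _ ⟨c, hc, rfl⟩
      refine ⟨c + d ⊓ |n|, ⟨hadd _ hc.1 _ heI, add_nonneg hc.2.1 he0, ?_⟩, by simp [sub_sub]⟩
      calc c + d ⊓ |n| ≤ x ⊓ v + d := add_le_add (le_inf hc.2.2 (hv hc)) inf_le_left
        _ = x := by rw [hd]; abel
  have hdd : d ∈ disjointCompl (disjointCompl I) :=
    isSolid_disjointCompl _ hxI (by rwa [abs_of_nonneg hd0, abs_of_nonneg hx])
  have hd_zero : d = 0 := eq_zero_of_abs_inf_self (hdd d hdI)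
  exact inf_eq_left.1 (sub_eq_zero.1 hd_zero).symm

/-! ### Order closed ideals and unbounded order convergence -/

theorem IsOrderClosed.mem_of_isLUB {S D : Set E} {x : E} (hS : IsOrderClosed S) (hDS : D ⊆ S)
    (hne : D.Nonempty) (hdir : DirectedOn (· ≤ ·) D) (hx : IsLUB D x) : x ∈ S := by
  have hdir' : IsDirectedOrder D := ⟨fun a b =>
    let ⟨c, hc, hac, hbc⟩ := hdir a a.2 b b.2
    ⟨⟨c, hc⟩, hac, hbc⟩⟩
  have hne' : Nonempty D := hne.to_subtype
  refine hS D (fun d => (d : E)) x (fun d => hDS d.2)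
    ⟨D, inferInstance, hdir', hne', fun d => x - d,
      fun a b hab => sub_le_sub_left (Subtype.coe_le_coe.2 hab) x,
      ⟨?_, fun b hb => ?_⟩, fun β => ⟨β, fun α hα => ?_⟩⟩
  · rintro _ ⟨d, rfl⟩
    exact sub_nonneg.2 (hx.1 d.2)
  · have : x ≤ x - b := hx.2 fun d hd => le_sub_comm.1 (hb ⟨⟨d, hd⟩, rfl⟩)
    simpa using this
  · rw [abs_sub_comm, abs_of_nonneg (sub_nonneg.2 (hx.1 α.2))]
    exact sub_le_sub_left (Subtype.coe_le_coe.2 hα) x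

/-- An order closed ideal contains its double disjoint complement. -/
theorem IsArchimedean.disjointCompl_disjointCompl_subset (hArch : IsArchimedean E)
    {I : Set E} (h0 : (0 : E) ∈ I) (hsolid : IsSolid I) (hadd : ∀ x ∈ I, ∀ y ∈ I, x + y ∈ I)
    (hclosed : IsOrderClosed I) : disjointCompl (disjointCompl I) ⊆ I := by
  intro x hx
  have hx' : |x| ∈ disjointCompl (disjointCompl I) :=
    isSolid_disjointCompl _ hx (abs_abs x).le
  have hLUB := hArch.isLUB_of_mem_disjointCompl_disjointCompl h0 hsolid hadd (abs_nonneg x) hx'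
  suffices hdir : DirectedOn (· ≤ ·) {c | c ∈ I ∧ 0 ≤ c ∧ c ≤ |x|} from
    hsolid (hclosed.mem_of_isLUB (D := {c | c ∈ I ∧ 0 ≤ c ∧ c ≤ |x|}) (fun c hc => hc.1)
      ⟨0, h0, le_rfl, abs_nonneg x⟩ hdir hLUB) (abs_abs x).ge
  rintro a ⟨haI, ha0, hax⟩ b ⟨hbI, hb0, hbx⟩
  refine ⟨a ⊔ b, ⟨hsolid (hadd a haI b hbI) ?_, le_sup_of_le_left ha0, sup_le hax hbx⟩,
    le_sup_left, le_sup_right⟩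
  rw [abs_of_nonneg (le_sup_of_le_left ha0), abs_of_nonneg (add_nonneg ha0 hb0)]
  exact sup_le (le_add_of_nonneg_right hb0) (le_add_of_nonneg_left ha0)

/-- The criterion for unbounded order convergence: closeness to `a` at a rate given by a normal
sequence `W` of order closed sets, together with disjointness of `s n - a` from `⋂ n, W n`. -/
theorem uoTendsto_of_normalSolidSequence [TopologicalSpace E] (hArch : IsArchimedean E)
    {W : ℕ → Set E} (hW : IsNormalSolidSequence W) (hclosed : ∀ n, IsOrderClosed (W n))
    {s : ℕ → E} {a : E} (hs : ∀ n, s (n + 1) - a ∈ W n)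
    (hsd : ∀ n, s n - a ∈ disjointCompl (⋂ n, W n)) : UOTendsto s a := by
  intro y
  set t : ℕ → E := fun n => |s n - a| ⊓ |y| with ht
  have ht0 : ∀ n, 0 ≤ t n := fun n => le_inf (abs_nonneg _) (abs_nonneg _)
  have htW : ∀ n, t (n + 1) ∈ W n := fun n =>
    hW.solid n (hs n) (by rw [abs_of_nonneg (ht0 _)]; exact inf_le_left)
  let U : Set E := {u | ∃ n, ∀ m, n ≤ m → t m ≤ u}
  have hUne : U.Nonempty := ⟨|y|, 0, fun m _ => inf_le_right⟩
  have hU0 : ∀ u ∈ U, 0 ≤ u := fun u ⟨n, hn⟩ => (ht0 n).trans (hn n le_rfl)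
  have hlow : ∀ w ∈ lowerBounds U, 0 ≤ w → w = 0 := by
    intro w hw hw0
    have hwd : w ∈ disjointCompl (⋂ n, W n) := by
      intro n hn
      rw [abs_of_nonneg hw0]
      refine hArch.eq_zero_of_sub_mem hUne hw (le_inf hw0 (abs_nonneg n)) ?_
      rintro u ⟨k, hk⟩
      refine ⟨k, fun m hm => le_sub_iff_add_le.2 (add_le_of_inf_eq_zero ?_ (hk m hm) ?_)⟩
      · exact inf_eq_zero_of_le (ht0 m) (le_inf hw0 (abs_nonneg n)) inf_le_left inf_le_right
          (hsd m n hn)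
      · exact inf_le_left.trans (hw ⟨k, hk⟩)
    have hwN : w ∈ ⋂ n, W n := by
      refine mem_iInter.2 fun j => ?_
      -- The tail starts at `j + 2` because `t (n + 1)` is only known to lie in `W n`.
      set σ : ℕ → E := fun p => partialSups (fun i => t (j + 2 + i)) p with hσ
      have hσ0 : ∀ p, 0 ≤ σ p := fun p =>
        (ht0 _).trans (le_partialSups (fun i => t (j + 2 + i)) p)
      have hσW : ∀ p, σ p ∈ W j := hW.partialSups_mem (fun i => ht0 _) fun i => by
        have := htW (j + 1 + i)
        rwa [add_right_comm (j + 1) i 1] at this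
      have hσmono : Monotone fun p => σ p ⊓ w := fun p q hpq =>
        inf_le_inf_right w ((partialSups fun i => t (j + 2 + i)).monotone hpq)
      refine (hclosed j).mem_of_isLUB (D := range fun p => σ p ⊓ w) ?_ (range_nonempty _) ?_
        ⟨?_, fun v hv => ?_⟩
      · rintro _ ⟨p, rfl⟩
        refine hW.solid j (hσW p) ?_
        dsimp only
        rw [abs_of_nonneg (le_inf (hσ0 p) hw0), abs_of_nonneg (hσ0 p)]
        exact inf_le_left
      · exact directedOn_range.2 hσmono.directed_le
      · rintro _ ⟨p, rfl⟩
        exact inf_le_right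
      · -- Upper bounds of the tail stay upper bounds after subtraction of `w - w ⊓ v`.
        have hd : w - w ⊓ v = 0 := by
          refine hArch.eq_zero_of_sub_mem
            (U := {u | ∀ p, σ p ≤ u}) (b := 0) ⟨|y|, fun p => ?_⟩ ?_
            (sub_nonneg.2 inf_le_left) ?_
          · exact partialSups_le _ _ _ fun i _ => inf_le_right
          · exact fun u hu => (hσ0 0).trans (hu 0)
          · intro u hu p
            have huU : u ∈ U := by
              refine ⟨j + 2, fun m hm => ?_⟩
              obtain ⟨i, rfl⟩ := Nat.exists_eq_add_of_le hm
              exact (le_partialSups (fun i => t (j + 2 + i)) i).trans (hu i)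
            rw [le_sub_iff_add_le]
            calc σ p + (w - w ⊓ v) = (σ p + w) - w ⊓ v := by abel
              _ = (σ p ⊓ w + σ p ⊔ w) - w ⊓ v := by rw [inf_add_sup]
              _ ≤ (w ⊓ v + u) - w ⊓ v :=
                sub_le_sub_right (add_le_add (le_inf inf_le_right (hv ⟨p, rfl⟩))
                  (sup_le (hu p) (hw huU))) _
              _ = u := by abel
        exact inf_eq_left.1 (sub_eq_zero.1 hd).symm
    exact eq_zero_of_abs_inf_self (hwd w hwN)
  have hUdir : IsDirectedOrder Uᵒᵈ := ⟨fun p q => by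
    obtain ⟨u, n, hn⟩ := p
    obtain ⟨v, k, hk⟩ := q
    refine ⟨OrderDual.toDual ⟨u ⊓ v, max n k, fun m hm => le_inf (hn m (le_of_max_le_left hm))
      (hk m (le_of_max_le_right hm))⟩, ?_, ?_⟩
    · exact (inf_le_left : u ⊓ v ≤ u)
    · exact (inf_le_right : u ⊓ v ≤ v)⟩
  have hUne' : Nonempty Uᵒᵈ := hUne.to_subtype
  refine ⟨Uᵒᵈ, inferInstance, hUdir, hUne', fun u => ((OrderDual.ofDual u : U) : E),
    fun p q hpq => hpq, ⟨?_, fun b hb => ?_⟩, fun β => ?_⟩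
  · rintro _ ⟨u, rfl⟩
    exact hU0 _ (OrderDual.ofDual u).2
  · have hb' : b ⊔ 0 ∈ lowerBounds U := fun u hu =>
      sup_le (hb ⟨OrderDual.toDual ⟨u, hu⟩, rfl⟩) (hU0 u hu)
    exact sup_eq_right.1 (hlow _ hb' le_sup_right)
  · obtain ⟨n, hn⟩ := (OrderDual.ofDual β).2
    refine ⟨n, fun m hm => ?_⟩
    rw [sub_zero, abs_of_nonneg (ht0 m)]
    exact hn m hm

/-! ### The carrier -/

theorem isSolid_carrier [TopologicalSpace E] : IsSolid (carrier E) := fun _ ⟨V, hV, hx⟩ _ hyx =>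
  ⟨V, hV, isSolid_disjointCompl _ hx hyx⟩

theorem carrier_eq_univ_of_iInter_subset [TopologicalSpace E] {V : ℕ → Set E}
    (hV : IsNormalSolidSequence V) (h : ⋂ n, V n ⊆ {0}) : carrier E = univ :=
  eq_univ_of_forall fun x => ⟨V, hV, disjointCompl_anti h (by
    rw [disjointCompl_singleton_zero]; exact mem_univ x)⟩

end Order

section Topology

variable {E : Type u} [AddCommGroup E] [Lattice E] [Module ℝ E] [TopologicalSpace E]

/-- Any sequence of neighbourhoods of zero can be refined to a normal sequence of order closed
sets; this is where the Fatou property enters. -/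
theorem IsFatouTopology.exists_normal_orderClosed_refinement (hE : IsFatouTopology E)
    {U : ℕ → Set E} (hU : ∀ n, U n ∈ 𝓝 (0 : E)) :
    ∃ V : ℕ → Set E, IsNormalSolidSequence V ∧ (∀ n, IsOrderClosed (V n)) ∧ ∀ n, V n ⊆ U n := by
  have := hE.isTopologicalAddGroup
  have hstep : ∀ T : {T : Set E // T ∈ 𝓝 (0 : E)}, ∃ T' : {T : Set E // T ∈ 𝓝 (0 : E)},
      IsSolid T'.1 ∧ IsOrderClosed T'.1 ∧ T'.1 + T'.1 ⊆ T.1 := by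
    rintro ⟨T, hT⟩
    obtain ⟨T₁, hT₁, hadd⟩ := exists_nhds_zero_half hT
    obtain ⟨T₂, hT₂, hs, hc, hsub⟩ := hE.fatou_basis T₁ hT₁
    refine ⟨⟨T₂, hT₂⟩, hs, hc, ?_⟩
    rintro _ ⟨x, hx, y, hy, rfl⟩
    exact hadd x (hsub hx) y (hsub hy)
  choose f hf using hstep
  let V : ℕ → {T : Set E // T ∈ 𝓝 (0 : E)} := fun n =>
    Nat.rec (f ⟨U 0, hU 0⟩) (fun k T => f ⟨T.1 ∩ U (k + 1), inter_mem T.2 (hU (k + 1))⟩) n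
  have hself : ∀ T, (f T).1 ⊆ T.1 := fun T x hx => by
    simpa using (hf T).2.2 (add_mem_add hx (mem_of_mem_nhds (f T).2))
  refine ⟨fun n => (V n).1, ⟨fun n => (V n).2, fun n => ?_, fun n => ?_⟩, fun n => ?_, fun n => ?_⟩
  · cases n with
    | zero => exact (hf _).1
    | succ n => exact (hf _).1
  · exact (hf _).2.2.trans inter_subset_left
  · cases n with
    | zero => exact (hf _).2.1
    | succ n => exact (hf _).2.1
  · cases n with
    | zero => exact hself _
    | succ n => exact (hself _).trans inter_subset_right

/-- Countably many normal sequences have a common refinement, so a countable subset of the carrier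
lies in the disjoint complement of a single kernel. -/
theorem IsFatouTopology.exists_subset_disjointCompl (hE : IsFatouTopology E) {T : Set E}
    (hT : T.Countable) (hTC : T ⊆ carrier E) {U : ℕ → Set E} (hU : ∀ n, U n ∈ 𝓝 (0 : E)) :
    ∃ V : ℕ → Set E, IsNormalSolidSequence V ∧ (∀ n, IsOrderClosed (V n)) ∧ (∀ n, V n ⊆ U n) ∧
      T ⊆ disjointCompl (⋂ n, V n) := by
  rcases T.eq_empty_or_nonempty with rfl | hne
  · obtain ⟨V, hV, hc, hVU⟩ := hE.exists_normal_orderClosed_refinement hU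
    exact ⟨V, hV, hc, hVU, empty_subset _⟩
  obtain ⟨x, rfl⟩ := hT.exists_eq_range hne
  choose P hP hxP using fun k => hTC (mem_range_self k)
  obtain ⟨V, hV, hc, hVP⟩ := hE.exists_normal_orderClosed_refinement
    (U := fun n => (⋂ k ∈ Finset.range (n + 1), P k n) ∩ U n) fun n =>
      inter_mem ((Finset.iInter_mem_sets _).2 fun k _ => (hP k).mem_nhds n) (hU n)
  refine ⟨V, hV, hc, fun n => (hVP n).trans inter_subset_right, ?_⟩
  rintro _ ⟨k, rfl⟩
  refine disjointCompl_anti (fun v hv => mem_iInter.2 fun n => ?_) (hxP k)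
  have h1 := (hVP (max k n) (mem_iInter.1 hv _)).1
  have h2 : v ∈ P k (max k n) :=
    mem_iInter₂.1 h1 k (Finset.mem_range.2 (Nat.lt_succ_of_le (le_max_left k n)))
  exact (hP k).antitone (le_max_right k n) h2

variable [IsOrderedAddMonoid E]

theorem IsFatouTopology.zero_mem_carrier (hE : IsFatouTopology E) : (0 : E) ∈ carrier E := by
  obtain ⟨V, hV, -⟩ := hE.exists_normal_orderClosed_refinement (U := fun _ => univ)
    fun _ => univ_mem
  exact ⟨V, hV, zero_mem_disjointCompl _⟩

theorem IsFatouTopology.add_mem_carrier (hE : IsFatouTopology E) :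
    ∀ x ∈ carrier E, ∀ y ∈ carrier E, x + y ∈ carrier E := by
  intro x hx y hy
  obtain ⟨V, hV, -, -, h⟩ := hE.exists_subset_disjointCompl (T := {x, y}) (by simp)
    (by rintro z (rfl | rfl) <;> assumption) (U := fun _ => univ) fun _ => univ_mem
  exact ⟨V, hV, add_mem_disjointCompl (h (by simp)) (h (by simp))⟩

/-- The carrier is order dense: a non-zero `x` lies outside the kernel `N` of some normal sequence,
and `N` contains `N^dd`, so `x` is not disjoint from `N^d`, which is part of the carrier. -/
theorem IsFatouTopology.disjointCompl_carrier (hArch : IsArchimedean E) (hE : IsFatouTopology E) :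
    disjointCompl (carrier E) = {0} := by
  refine Subset.antisymm (fun x hx => ?_) (singleton_subset_iff.2 (zero_mem_disjointCompl _))
  by_contra hne
  have := hE.t2Space
  obtain ⟨V, hV, hc, hVU⟩ := hE.exists_normal_orderClosed_refinement (U := fun _ => {x}ᶜ)
    fun _ => isOpen_compl_singleton.mem_nhds (Ne.symm hne)
  have hxN : x ∈ ⋂ n, V n :=
    hArch.disjointCompl_disjointCompl_subset hV.zero_mem_iInter hV.isSolid_iInter
      hV.add_mem_iInter (isOrderClosed_iInter hc)
      (disjointCompl_anti (T := carrier E) (fun y hy => ⟨V, hV, hy⟩) hx)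
  exact hVU 0 (mem_iInter.1 hxN 0) rfl

theorem IsFatouTopology.carrier_eq_univ_of_countableSupProperty (hArch : IsArchimedean E)
    (hE : IsFatouTopology E) (h : CountableSupProperty E) : carrier E = univ := by
  refine eq_univ_of_forall fun x => ?_
  suffices hmem : |x| ∈ carrier E from isSolid_carrier hmem (abs_abs x).ge
  have hx : |x| ∈ disjointCompl (disjointCompl (carrier E)) := by
    rw [hE.disjointCompl_carrier hArch, disjointCompl_singleton_zero]
    exact mem_univ _
  obtain ⟨T, hTS, hTc, hT⟩ := h _ _ (hArch.isLUB_of_mem_disjointCompl_disjointCompl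
    hE.zero_mem_carrier isSolid_carrier hE.add_mem_carrier (abs_nonneg x) hx)
  obtain ⟨V, hV, -, -, hTV⟩ := hE.exists_subset_disjointCompl hTc (fun c hc => (hTS hc).1)
    (U := fun _ => univ) fun _ => univ_mem
  exact ⟨V, hV, mem_disjointCompl_of_isLUB (abs_nonneg x) hTV hT⟩

theorem IsFatouTopology.carrier_eq_univ_of_countable_orderBasis (hArch : IsArchimedean E)
    (hE : IsFatouTopology E) {B : Set E} (hBc : B.Countable) (hB : IsOrderBasis B (carrier E)) :
    carrier E = univ := by
  obtain ⟨V, hV, -, -, hBV⟩ := hE.exists_subset_disjointCompl hBc hB.2.1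
    (U := fun _ => univ) fun _ => univ_mem
  refine carrier_eq_univ_of_iInter_subset hV fun n hn => ?_
  rw [← hE.disjointCompl_carrier hArch]
  intro c hc
  have h0 : 0 ≤ |n| ⊓ |c| := le_inf (abs_nonneg n) (abs_nonneg c)
  have hmem : |n| ⊓ |c| ∈ disjointCompl B ∩ carrier E := by
    refine ⟨fun b hb => ?_, isSolid_carrier hc (by rw [abs_of_nonneg h0]; exact inf_le_right)⟩
    rw [abs_of_nonneg h0]
    exact inf_eq_zero_of_le h0 (abs_nonneg b) inf_le_left le_rfl
      ((inf_comm _ _).trans (hBV hb n hn))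
  rw [hB.2.2] at hmem
  exact hmem

theorem IsFatouTopology.carrier_eq_univ_of_firstCountable (hE : IsFatouTopology E)
    [FirstCountableTopology E] : carrier E = univ := by
  have := hE.t2Space
  obtain ⟨U, hU⟩ := (𝓝 (0 : E)).exists_antitone_basis
  obtain ⟨V, hV, -, hVU⟩ := hE.exists_normal_orderClosed_refinement fun n => hU.mem n
  refine carrier_eq_univ_of_iInter_subset hV fun x hx => ?_
  by_contra hne
  obtain ⟨n, hn⟩ := hU.mem_iff.1 (isOpen_compl_singleton.mem_nhds (Ne.symm hne) : {x}ᶜ ∈ 𝓝 0)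
  exact hn (hVU n (mem_iInter.1 hx n)) rfl

/-! ### Embedded sequences -/

/-- Every index is followed, in the strict sense when there is no largest one, by arbitrarily late
indices. -/
theorem exists_ge_ge_and_lt {A : Type*} [Preorder A] [IsDirectedOrder A] (β γ : A) :
    ∃ δ, γ ≤ δ ∧ β ≤ δ ∧ ((¬ ∃ m : A, IsTop m) → β < δ) := by
  by_cases h : ∃ m : A, IsTop m
  · obtain ⟨δ, h1, h2⟩ := exists_ge_ge γ β
    exact ⟨δ, h1, h2, fun h' => absurd h h'⟩
  · obtain ⟨ε, hε⟩ : ∃ ε, ¬ ε ≤ β := by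
      by_contra! hall
      exact h ⟨β, hall⟩
    obtain ⟨δ₁, h1, h2⟩ := exists_ge_ge γ β
    obtain ⟨δ, h3, h4⟩ := exists_ge_ge δ₁ ε
    have hβδ := h2.trans h3
    exact ⟨δ, h1.trans h3, hβδ, fun _ => hβδ.lt_of_not_ge fun h5 => hε (h4.trans h5)⟩

theorem IsFatouTopology.exists_embedded_uoTendsto (hArch : IsArchimedean E)
    (hE : IsFatouTopology E) (hC : carrier E = univ) {A : Type*} [Preorder A] [IsDirectedOrder A]
    [Nonempty A] {x : A → E} {a : E} (hx : Tendsto x atTop (𝓝 a)) :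
    ∃ s : ℕ → E, IsEmbeddedSequence s x ∧ UOTendsto s a := by
  have := hE.isTopologicalAddGroup
  have hx0 : Tendsto (fun α => x α - a) atTop (𝓝 0) := by
    simpa using hx.sub_const a
  have hpick : ∀ (α : A) (U : ℕ → Set E), (∀ n, U n ∈ 𝓝 (0 : E)) → ∃ V : ℕ → Set E,
      (IsNormalSolidSequence V ∧ (∀ n, IsOrderClosed (V n)) ∧
        x α - a ∈ disjointCompl (⋂ n, V n)) ∧ ∀ n, V n ⊆ U n := by
    intro α U hU
    obtain ⟨V, hV, hc, hVU, h⟩ := hE.exists_subset_disjointCompl (countable_singleton (x α - a))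
      (by rw [hC]; exact subset_univ _) hU
    exact ⟨V, ⟨hV, hc, h rfl⟩, hVU⟩
  -- A state of the construction: an index together with a normal sequence adapted to it.
  let St := {p : A × (ℕ → Set E) // IsNormalSolidSequence p.2 ∧ (∀ n, IsOrderClosed (p.2 n)) ∧
    x p.1 - a ∈ disjointCompl (⋂ n, p.2 n)}
  have hstep : ∀ (n : ℕ) (p : St), ∃ q : St, (p.1.1 ≤ q.1.1 ∧
      ((¬ ∃ m : A, IsTop m) → p.1.1 < q.1.1)) ∧ x q.1.1 - a ∈ p.1.2 (n + 1) ∧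
      ∀ m, q.1.2 m ⊆ p.1.2 m := by
    rintro n ⟨⟨α, V⟩, hV, hVc, hαV⟩
    obtain ⟨γ, hγ⟩ := eventually_atTop.1 (hx0.eventually_mem (hV.mem_nhds (n + 1)))
    obtain ⟨δ, hγδ, hle, hlt⟩ := exists_ge_ge_and_lt α γ
    obtain ⟨V', hV', hsub⟩ := hpick δ V hV.mem_nhds
    exact ⟨⟨⟨δ, V'⟩, hV'⟩, ⟨hle, hlt⟩, hγ δ hγδ, hsub⟩
  choose f hf using hstep
  obtain ⟨α₀⟩ := ‹Nonempty A›
  obtain ⟨V₀, hV₀, -⟩ := hpick α₀ (fun _ => univ) fun _ => univ_mem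
  let g : ℕ → St := fun n => Nat.rec ⟨⟨α₀, V₀⟩, hV₀⟩ (fun n p => f n p) n
  have hg : ∀ n, g (n + 1) = f n (g n) := fun _ => rfl
  have hdec : ∀ n m, (g (n + 1)).1.2 m ⊆ (g n).1.2 m := fun n m => by
    rw [hg]; exact (hf n (g n)).2.2 m
  let W : ℕ → Set E := fun n => (g n).1.2 (n + 1)
  have hW : IsNormalSolidSequence W :=
    ⟨fun n => (g n).2.1.mem_nhds _, fun n => (g n).2.1.solid _,
      fun n => ((g (n + 1)).2.1.add_subset (n + 1)).trans (hdec n (n + 1))⟩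
  have hanti : ∀ m, Antitone fun n => (g n).1.2 m := fun m =>
    antitone_nat_of_succ_le fun n => hdec n m
  have hker : ∀ n, ⋂ k, W k ⊆ ⋂ m, (g n).1.2 m := by
    intro n v hv
    refine mem_iInter.2 fun m => ?_
    have h1 : v ∈ (g (max n m)).1.2 (max n m + 1) := mem_iInter.1 hv (max n m)
    have h2 : v ∈ (g n).1.2 (max n m + 1) := hanti _ (le_max_left n m) h1
    exact (g n).2.1.antitone ((le_max_right n m).trans (Nat.le_succ _)) h2
  refine ⟨fun n => x (g n).1.1, ⟨fun n => (g n).1.1, ?_, fun htop => ?_, fun _ => rfl⟩, ?_⟩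
  · exact monotone_nat_of_le_succ fun n => (hf n (g n)).1.1
  · exact strictMono_nat_of_lt_succ fun n => (hf n (g n)).1.2 htop
  · exact uoTendsto_of_normalSolidSequence hArch hW (fun n => (g n).2.2.1 _)
      (fun n => (hf n (g n)).2.1) fun n => disjointCompl_anti (hker n) (g n).2.2.2

end Topology

end VectorLattice

theorem mainTheorem2
    {E : Type u} [AddCommGroup E] [Lattice E] [IsOrderedAddMonoid E]
    [Module ℝ E] [IsOrderedModule ℝ E] [TopologicalSpace E]
    (hArch : VectorLattice.IsArchimedean E) (hFatou : VectorLattice.IsFatouTopology E) :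
    (VectorLattice.CountableSupProperty E → VectorLattice.carrier E = Set.univ) ∧
    ((∃ B : Set E, B.Countable ∧ VectorLattice.IsOrderBasis B (VectorLattice.carrier E)) →
      VectorLattice.carrier E = Set.univ) ∧
    (TopologicalSpace.MetrizableSpace E → VectorLattice.carrier E = Set.univ) ∧
    (VectorLattice.carrier E = Set.univ →
      ∀ (A : Type w) [Preorder A] [IsDirectedOrder A] [Nonempty A] (x : A → E) (a : E),
        Tendsto x atTop (𝓝 a) →
          ∃ s : ℕ → E, VectorLattice.IsEmbeddedSequence s x ∧ VectorLattice.UOTendsto s a) := by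
  refine ⟨hFatou.carrier_eq_univ_of_countableSupProperty hArch, ?_, fun _ => ?_, ?_⟩
  · rintro ⟨B, hBc, hB⟩
    exact hFatou.carrier_eq_univ_of_countable_orderBasis hArch hBc hB
  · exact hFatou.carrier_eq_univ_of_firstCountable
  · intro hC A _ _ _ x a hx
    exact hFatou.exists_embedded_uoTendsto hArch hC hx
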